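/- Let $f_0=f_1=1$, $f_i=f_{i-1}+f_{i-2}$ $(i\ge 2)$. For $n\in\mathbb{N}=\{0,1,2,\dots\}$ let $F(n)$ be the number of finite sets of Fibonacci numbers $f_i$ $(i\ge 1)$ whose sum is $n$ (so $F(0)=1$), and let $n=f_{i_1}+\dots+f_{i_q}$ with $i_1\ge 1$, $i_{r+1}-i_r\ge 2$ be the Zeckendorf representation of $n$. Put $\alpha_1=\lfloor (i_1-1)/2\rfloor+1$ and $\alpha_r=\lfloor (i_r-i_{r-1})/2\rfloor+1$ for $1<r\le q$. Cut the sequence $(i_1,\dots,i_q)$ into its maximal blocks of consecutive entries of equal parity, and let $A_1,\dots,A_s$ be the corresponding consecutive blocks of $(\alpha_1,\dots,\alpha_q)$. For a block $A=(a_1,\dots,a_m)$ put $$\langle A\rangle=\cfrac{1}{a_1-\cfrac{1}{a_2-\cdots-\cfrac{1}{a_m}}}\in\mathbb{Q}.$$ Let $\Gamma$ be the free monoid on the set of non-zero elements of $\mathbb{Q}/\mathbb{Z}$; regard a rational number $g$ as an element of $\Gamma$ through its class in $\mathbb{Q}/\mathbb{Z}$, the zero class being identified with the unit of $\Gamma$.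 Define $\pi:\mathbb{N}\to\Gamma$ by $\pi(n)=\langle A_1\rangle*\dots*\langle A_s\rangle$ (so $\pi(0)$ is the unit), and for $\gamma\in\Gamma$ let $\theta(\gamma)$ be the least element of $\pi^{-1}(\gamma)$. The numbers $\theta(\gamma)$, $\gamma\in\Gamma$, are called essential; an essential number $n$ with $F(n)=k$ is called an essential $k$-number. Then for every integer $k\ge 1$ the largest essential $k$-number exists and equals $f_{2k}-2$, and $f_{2k}-2=\theta\big((k-1)/k\big)$. -/

import Mathlib

namespace FibPart

/-- The Fibonacci numbers in the indexing `f 0 = f 1 = 1`, `f i = f (i - 1) + f (i - 2)`,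
so `f 1, f 2, f 3, f 4, … = 1, 2, 3, 5, …`. -/
def f (i : ℕ) : ℕ := Nat.fib (i + 1)

/-- The Fibonacci partitions of `n`: the finite sets of Fibonacci numbers `f i`, `i ≥ 1`,
with sum `n`. -/
def fibPartitions (n : ℕ) : Set (Finset ℕ) :=
  {S | (∀ m ∈ S, ∃ i, 1 ≤ i ∧ m = f i) ∧ ∑ m ∈ S, m = n}

theorem fibPartitions_finite (n : ℕ) : (fibPartitions n).Finite := by
  refine (Finset.finite_toSet (Finset.range (n + 1)).powerset).subset ?_
  rintro S ⟨-, hS⟩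
  simp only [Finset.coe_powerset, Set.mem_preimage, Set.mem_powerset_iff, Finset.coe_subset]
  intro m hm
  have : m ≤ ∑ m ∈ S, m := Finset.single_le_sum (f := fun m => m) (fun _ _ => Nat.zero_le _) hm
  exact Finset.mem_range.2 (by omega)

/-- The number of Fibonacci partitions of `n` (the set being counted is finite). -/
noncomputable def F (n : ℕ) : ℕ := (fibPartitions n).ncard

/-- The increasing list `[i₁, …, i_q]` of indices of the minimal Fibonacci partition (Zeckendorf
representation) `n = f i₁ + ⋯ + f i_q`, `i₁ ≥ 1`, `i_{a+1} - i_a ≥ 2`. Mathlib lists the indices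
in decreasing order, for `Nat.fib`, so each of them is at least `2` and is here lowered by one. -/
def Z (n : ℕ) : List ℕ := (n.zeckendorf.map (fun j => j - 1)).reverse

theorem two_le_of_isZeckendorfRep {l : List ℕ} (h : l.IsZeckendorfRep) : ∀ j ∈ l, 2 ≤ j := by
  have : IsTrans ℕ (fun a b : ℕ => b + 2 ≤ a) := ⟨fun _ _ _ h₁ h₂ => by omega⟩
  rw [List.IsZeckendorfRep, List.isChain_iff_pairwise, List.pairwise_append] at h
  intro j hj
  simpa using h.2.2 j hj 0 (by simp)

theorem sum_f_Z (n : ℕ) : ((Z n).map f).sum = n := by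
  conv_rhs => rw [← Nat.sum_zeckendorf_fib n]
  rw [Z, List.map_reverse, List.sum_reverse, List.map_map]
  refine congrArg List.sum (List.map_congr_left fun j hj => ?_)
  have := two_le_of_isZeckendorfRep (Nat.isZeckendorfRep_zeckendorf n) j hj
  simp only [Function.comp, f]
  congr 1
  omega

/-- The canonical form `(I₁; …; I_s)` of a 2-partition: the maximal runs of consecutive
entries of equal parity. -/
def canonicalForm (I : List ℕ) : List (List ℕ) := I.splitBy (fun a b => a % 2 == b % 2)

/-- The associated vector of a 2-partition `[i₁, …, i_q]`: `α₁ = ⌊(i₁ - 1) / 2⌋ + 1` and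
`α_r = ⌊(i_r - i_{r-1}) / 2⌋ + 1` for `r > 1` (so the convention `i₀ = 1` covers both cases). -/
def assocVec (I : List ℕ) : List ℕ := List.zipWith (fun a b => (b - a) / 2 + 1) (1 :: I) I

/-- The associated multivector `A₁ × ⋯ × A_s` of a 2-partition: the associated vector, cut into
consecutive blocks whose lengths are those of the simple components `I₁, …, I_s`. -/
def multivec (I : List ℕ) : List (List ℕ) :=
  ((canonicalForm I).map List.length).splitLengths (assocVec I)

/-- The continued fraction `⟨α₁, …, α_q⟩ = 1 / (α₁ - 1 / (α₂ - ⋯ - 1 / α_q))`. -/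
def cf : List ℕ → ℚ
  | [] => 0
  | a :: l => 1 / ((a : ℚ) - cf l)

/-- The free monoid on the nonzero elements of the group `ℚ / ℤ` (`AddCircle (1 : ℚ)` is
the quotient of `ℚ` by the subgroup generated by `1`). -/
abbrev Gam : Type := FreeMonoid {x : AddCircle (1 : ℚ) // x ≠ 0}

open Classical in
/-- The element of the free monoid given by the class of `g` in `ℚ / ℤ`: a one-letter word if
`g` is not an integer, and the unit if it is. -/
noncomputable def letter (g : ℚ) : Gam :=
  if h : (g : AddCircle (1 : ℚ)) = 0 then 1 else FreeMonoid.of ⟨(g : AddCircle (1 : ℚ)), h⟩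

/-- `p (A₁ × ⋯ × A_s) = ⟨A₁⟩ * ⋯ * ⟨A_s⟩`, each factor being read modulo `ℤ`. -/
noncomputable def p (A : List (List ℕ)) : Gam := (A.map (fun a => letter (cf a))).prod

/-- The projection from the natural numbers onto the free monoid. -/
noncomputable def proj (n : ℕ) : Gam := p (multivec (Z n))

theorem proj_zero : proj 0 = 1 := by
  simp [proj, p, multivec, canonicalForm, Z]

/-- `θ γ` is the lowest number in the fibre of `proj` over `γ`. (Were a fibre empty, the value
would be `0`, which is also `θ 1`, so the set of values of `θ` does not depend on this.) -/
noncomputable def θ (γ : Gam) : ℕ := sInf {n | proj n = γ}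

/-- The essential numbers. -/
def essential : Set ℕ := Set.range θ

/-- The essential `k`-numbers. -/
def essentialK (k : ℕ) : Set ℕ := {n | n ∈ essential ∧ F n = k}

end FibPart

namespace FibPart

-- Along the Zeckendorf indices the partition counts of the partial sums satisfy x_r = α_r x_{r-1} -
-- ε x_{r-2}, with ε = 1 if i_{r-1}, i_r have equal parity and 0 otherwise. This is the recursion of
-- continuants, restarted at each parity change, so F(n) is the product of the continuants of the
-- blocks (`F_eq_prod_cont`). A continuant is the denominator of its continued fraction, hence F(n)
-- is the product of the orders in ℚ/ℤ of the letters of π(n) (`order_proj`). The essential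
-- k-numbers are therefore the values θ(γ) with γ of order k.
--
-- Upper bound: each letter of order d has an expansion with entries at least 2 and weight at most d
-- - 1 (`exists_cf_eq`). Realizing these expansions by indices as small as possible
-- (`exists_blocks_eq`) keeps the largest index at most 2k - 1, whence θ(γ) ≤ f(2k) - 2
-- (`θ_add_two_le`).
--
-- Lower bound for the class of (k-1)/k, k ≥ 2: either the multivector is the single block of k - 1
-- twos, and n is at least f(3) + f(5) + ⋯ + f(2k-1) = f(2k) - 2, or the first entry is 1, and the
-- weight of the rest forces an index at least 2k (`of_p_eq_letter`, `f_le_of_proj_eq`).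

-- Multivectors by recursion, and continuants

/-- The entry of the associated vector determined by two neighbouring indices. -/
def gap (a b : ℕ) : ℕ := (b - a) / 2 + 1

/-- Put `a` in front of the first block. -/
def consHead (a : ℕ) : List (List ℕ) → List (List ℕ)
  | [] => [[a]]
  | H :: T => (a :: H) :: T

/-- The associated multivector of `I`, where `prev` plays the role of the index before the first
one, computed recursively. -/
def blocks : ℕ → List ℕ → List (List ℕ)
  | _, [] => []
  | prev, [i] => [[gap prev i]]
  | prev, i :: j :: I =>
    if i % 2 = j % 2 then consHead (gap prev i) (blocks i (j :: I))
    else [gap prev i] :: blocks i (j :: I)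

/-- The accumulators `g` and `gs` are only prepended to the output; choosing `H` and `T` before them
makes the loop usable as a structural recursion. -/
theorem splitBy_loop_eq (r : ℕ → ℕ → Bool) (l : List ℕ) : ∀ a : ℕ, ∃ H T, ∀ g gs,
    List.splitBy.loop r l a g gs = gs.reverse ++ (g.reverse ++ H) :: T := by
  induction l with
  | nil => exact fun a => ⟨[a], [], fun g gs => by simp [List.splitBy.loop]⟩
  | cons b l ih =>
    intro a
    obtain ⟨H, T, h⟩ := ih b
    by_cases hab : r a b
    · exact ⟨a :: H, T, fun g gs => by simp [List.splitBy.loop, hab, h]⟩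
    · exact ⟨[a], H :: T, fun g gs => by simp [List.splitBy.loop, hab, h]⟩

theorem splitBy_cons_cons (r : ℕ → ℕ → Bool) (a b : ℕ) (l : List ℕ) :
    ∃ H T, (b :: l).splitBy r = H :: T ∧
      (a :: b :: l).splitBy r = if r a b then (a :: H) :: T else [a] :: H :: T := by
  obtain ⟨H, T, h⟩ := splitBy_loop_eq r l b
  refine ⟨H, T, by simp [List.splitBy, h], ?_⟩
  by_cases hab : r a b <;> simp [List.splitBy, List.splitBy.loop, hab, h]

theorem splitLengths_canonicalForm (I : List ℕ) : ∀ prev,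
    ((canonicalForm I).map List.length).splitLengths (List.zipWith gap (prev :: I) I) =
      blocks prev I := by
  induction I with
  | nil => intro prev; simp [canonicalForm, blocks]
  | cons i I ih =>
    intro prev
    cases I with
    | nil => simp [canonicalForm, blocks, List.splitBy, List.splitBy.loop]
    | cons j I =>
      obtain ⟨H, T, h₁, h₂⟩ := splitBy_cons_cons (fun a b => a % 2 == b % 2) i j I
      have := ih i
      simp only [canonicalForm, h₁, List.map_cons, List.splitLengths_cons] at this
      rw [canonicalForm, h₂, blocks, ← this]
      by_cases hij : i % 2 = j % 2
      · simp [hij, consHead]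
      · simp [hij]

theorem multivec_eq_blocks (I : List ℕ) : multivec I = blocks 1 I :=
  splitLengths_canonicalForm I 1

theorem blocks_cons (prev i : ℕ) (I : List ℕ) : ∃ H T, blocks prev (i :: I) = (gap prev i :: H) :: T := by
  cases I with
  | nil => exact ⟨[], [], rfl⟩
  | cons j I =>
    by_cases h : i % 2 = j % 2
    · rcases e : blocks i (j :: I) with _ | ⟨H, T⟩
      · exact ⟨[], [], by simp [blocks, h, consHead, e]⟩
      · exact ⟨H, T, by simp [blocks, h, consHead, e]⟩
    · exact ⟨[], blocks i (j :: I), by simp [blocks, h]⟩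

theorem blocks_cons_cons (prev i j : ℕ) (I : List ℕ) : ∃ H T, blocks i (j :: I) = (gap i j :: H) :: T ∧
    (i % 2 = j % 2 → blocks prev (i :: j :: I) = (gap prev i :: gap i j :: H) :: T) ∧
    (i % 2 ≠ j % 2 → blocks prev (i :: j :: I) = [gap prev i] :: (gap i j :: H) :: T) := by
  obtain ⟨H, T, h⟩ := blocks_cons i j I
  exact ⟨H, T, h, fun e => by simp [blocks, e, h, consHead], fun e => by simp [blocks, e, h]⟩

/-- The recursion for the number of Fibonacci partitions along the Zeckendorf indices. -/
def run : ℕ → ℤ → ℤ → List ℕ → ℤ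
  | _, x, _, [] => x
  | prev, x, y, i :: I => run i (gap prev i * x - if prev % 2 = i % 2 then y else 0) x I

mutual
/-- The continuant of a list, the denominator of `cf`. -/
def cont : List ℕ → ℤ
  | [] => 1
  | a :: l => a * cont l - contTail l
/-- The continuant of the tail of a list, the numerator of `cf`. -/
def contTail : List ℕ → ℤ
  | [] => 0
  | _ :: l => cont l
end

/-- Each step of `run` is linear in `(x, y)`, and within a block the coefficients are continuants.
At a parity change `y` is dropped, so the finished block splits off as a factor. -/
theorem run_eq (I : List ℕ) : ∀ prev i x y, ∃ H T, blocks prev (i :: I) = (gap prev i :: H) :: T ∧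
    run prev x y (i :: I) = (cont (gap prev i :: H) * x -
      (if prev % 2 = i % 2 then y else 0) * contTail (gap prev i :: H)) * (T.map cont).prod := by
  induction I with
  | nil => exact fun prev i x y => ⟨[], [], rfl, by simp [run, cont, contTail]⟩
  | cons j I ih =>
    intro prev i x y
    obtain ⟨H, T, h, hs, hd⟩ := blocks_cons_cons prev i j I
    obtain ⟨H', T', h', e⟩ := ih i j (gap prev i * x - if prev % 2 = i % 2 then y else 0) x
    obtain ⟨rfl, rfl⟩ : H = H' ∧ T = T' := by simpa using h.symm.trans h'
    rw [run, e]
    by_cases hij : i % 2 = j % 2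
    · refine ⟨_, _, hs hij, ?_⟩
      simp only [hij, if_true, cont, contTail]
      ring
    · refine ⟨_, _, hd hij, ?_⟩
      simp only [hij, if_false, cont, contTail, List.map_cons, List.prod_cons]
      ring

theorem run_one (I : List ℕ) : run 1 1 0 I = ((blocks 1 I).map cont).prod := by
  cases I with
  | nil => simp [run, blocks]
  | cons i I =>
    obtain ⟨H, T, h, e⟩ := run_eq I 1 i 1 0
    rw [e, h]
    simp

-- Counting partitions with bounded parts

theorem f_add_two (i : ℕ) : f (i + 2) = f (i + 1) + f i := by
  simp only [f]; rw [Nat.fib_add_two]; ring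

theorem f_mono : Monotone f := fun _ _ h => Nat.fib_mono (by omega)

theorem f_pos (i : ℕ) : 0 < f i := Nat.fib_pos.2 (by omega)

theorem f_strictMonoOn : StrictMonoOn f (Set.Ici 1) := by
  intro a ha b hb h
  simp only [Set.mem_Ici] at ha hb
  exact (Nat.fib_lt_fib (by omega)).2 (by omega)

/-- The number of sets of Fibonacci numbers `f i`, `1 ≤ i ≤ m`, with sum `n`. -/
def count : ℕ → ℕ → ℕ
  | 0, n => if n = 0 then 1 else 0
  | m + 1, n => count m n + if f (m + 1) ≤ n then count m (n - f (m + 1)) else 0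

theorem count_eq_card (m : ℕ) : ∀ n, count m n =
    (((Finset.Icc 1 m).image f).powerset.filter (fun S => ∑ x ∈ S, x = n)).card := by
  induction m with
  | zero =>
    intro n
    by_cases h : n = 0
    · subst h; simp [count, Finset.filter_singleton]
    · simp [count, h, Finset.filter_singleton, Ne.symm h]
  | succ m ih =>
    intro n
    have hnot : f (m + 1) ∉ (Finset.Icc 1 m).image f := by
      simp only [Finset.mem_image, Finset.mem_Icc, not_exists, not_and]
      intro i hi
      exact (f_strictMonoOn (Set.mem_Ici.2 hi.1) (Set.mem_Ici.2 (by omega)) (by omega)).ne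
    have hns : ∀ S ∈ ((Finset.Icc 1 m).image f).powerset, f (m + 1) ∉ S :=
      fun S hS h => hnot (Finset.mem_powerset.1 hS h)
    have hins : (Finset.Icc 1 (m + 1)).image f = insert (f (m + 1)) ((Finset.Icc 1 m).image f) := by
      rw [← Finset.insert_Icc_right_eq_Icc_add_one (by omega), Finset.image_insert]
    rw [hins, Finset.powerset_insert, Finset.filter_union, Finset.card_union_of_disjoint, count, ih]
    · congr 1
      rw [Finset.filter_image, Finset.card_image_of_injOn]
      · split_ifs with h
        · rw [ih]
          congr 1
          refine Finset.filter_congr fun S hS => ?_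
          rw [Finset.sum_insert (hns S hS)]
          omega
        · symm
          rw [Finset.card_eq_zero, Finset.filter_eq_empty_iff]
          intro S hS
          rw [Finset.sum_insert (hns S hS)]
          omega
      · intro S hS S' hS' e
        simp only [Finset.coe_filter, Set.mem_ofPred_eq] at hS hS'
        rw [← Finset.erase_insert (hns S hS.1), ← Finset.erase_insert (hns S' hS'.1), e]
    · rw [Finset.disjoint_left]
      intro S hS hS'
      simp only [Finset.mem_filter, Finset.mem_image] at hS hS'
      obtain ⟨⟨S', _, rfl⟩, _⟩ := hS'
      exact hns _ hS.1 (Finset.mem_insert_self _ _)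

theorem F_eq_count {m n : ℕ} (h : n < f (m + 1)) : F n = count m n := by
  rw [F, count_eq_card, ← Set.ncard_coe_finset]
  congr 1
  ext S
  simp only [fibPartitions, Set.mem_ofPred_eq, Finset.coe_filter, Finset.mem_powerset]
  refine and_congr_left fun hS => ⟨fun hf x hx => ?_, fun hf x hx => ?_⟩
  · obtain ⟨i, hi, rfl⟩ := hf x hx
    have : f i ≤ n := hS ▸ Finset.single_le_sum (f := fun m => m) (fun _ _ => Nat.zero_le _) hx
    have : i < m + 1 := f_mono.reflect_lt (this.trans_lt h)
    exact Finset.mem_image_of_mem f (Finset.mem_Icc.2 ⟨hi, by omega⟩)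
  · obtain ⟨i, hi, rfl⟩ := Finset.mem_image.1 (hf hx)
    exact ⟨i, (Finset.mem_Icc.1 hi).1, rfl⟩

/-- All available parts together sum only to `f (m + 2) - 2`. -/
theorem count_eq_zero {m : ℕ} : ∀ {n}, f (m + 2) ≤ n + 1 → count m n = 0 := by
  induction m with
  | zero => intro n h; rw [zero_add, show f 2 = 2 from rfl] at h; simp [count]; omega
  | succ m ih =>
    intro n h
    rw [show m + 1 + 2 = m + 3 by ring] at h
    have h₁ : f (m + 3) = f (m + 2) + f (m + 1) := f_add_two (m + 1)
    have := f_pos (m + 1)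
    rw [count, ih (by omega), ih (by omega)]
    simp

theorem count_eq_of_lt {m j n : ℕ} (hjm : j ≤ m) (h : n < f (j + 1)) : count m n = count j n := by
  rw [← F_eq_count h, F_eq_count (m := m) (h.trans_le (f_mono (by omega)))]

theorem count_succ_add (m n : ℕ) : count (m + 1) (f (m + 1) + n) =
    count m (f (m + 1) + n) + count m n := by
  simp [count]

/-- Without `f (m + 1)` the remaining parts are too small, so that part is forced. -/
theorem count_self_add (m n : ℕ) : count (m + 1) (f (m + 2) + n) = count m (f m + n) := by
  rw [count, if_pos (by rw [f_add_two]; omega), count_eq_zero (by omega), f_add_two]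
  simp only [zero_add]
  congr 1
  omega

/-- The partitions of `f (j + d) + n` not using `f (j + d)`. -/
theorem count_pred_even (j n c : ℕ) (h₁ : f (j + 1) ≤ n + 1) (h₂ : n < f (j + 2)) :
    count (j + 2 * c + 2) (f (j + 2 * c + 3) + n) = c * count (j + 1) n + count j n := by
  induction c with
  -- Splitting has descended to `f (j + 1)` itself: that part is forced, and `n` must then be
  -- partitioned without it.
  | zero =>
    rw [count_self_add, show j + 2 * 0 + 1 = j + 1 by ring, count_succ_add, count_eq_zero]
    · ring
    · have := f_mono (Nat.le_add_right j 1)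
      rw [f_add_two]
      omega
  | succ c ih =>
    rw [count_self_add, show j + 2 * (c + 1) + 1 = (j + 2 * c + 2) + 1 by ring, count_succ_add, ih,
      count_eq_of_lt (m := _ + 2 * c + _) (j := j + 1) (by omega) h₂]
    ring

theorem count_pred_odd (j n c : ℕ) (h₁ : f (j + 1) ≤ n + 1) (h₂ : n < f (j + 2)) :
    count (j + 2 * c + 3) (f (j + 2 * c + 4) + n) = (c + 1) * count (j + 1) n := by
  induction c with
  | zero =>
    rw [count_self_add, show j + 2 * 0 + 2 = j + 1 + 1 by ring, count_succ_add, count_self_add,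
      count_eq_zero (by rw [f_add_two]; omega)]
    ring
  | succ c ih =>
    rw [count_self_add, show j + 2 * (c + 1) + 2 = (j + 2 * c + 3) + 1 by ring, count_succ_add, ih,
      count_eq_of_lt (m := _ + 2 * c + _) (j := j + 1) (by omega) h₂]
    ring

theorem count_step (j n i : ℕ) (x y : ℤ) (h₁ : f (j + 1) ≤ n + 1) (h₂ : n < f (j + 2))
    (hx : (count (j + 1) n : ℤ) = x) (hy : (count j n : ℤ) = x - y) (hi : j + 3 ≤ i + 1) :
    (count (i + 1) (f (i + 1) + n) : ℤ) =
      gap (j + 1) (i + 1) * x - (if (j + 1) % 2 = (i + 1) % 2 then y else 0) ∧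
    (count i (f (i + 1) + n) : ℤ) =
      gap (j + 1) (i + 1) * x - (if (j + 1) % 2 = (i + 1) % 2 then y else 0) - x := by
  rw [count_succ_add, count_eq_of_lt (m := i) (j := j + 1) (by omega) h₂, Nat.cast_add, hx]
  suffices h : (count i (f (i + 1) + n) : ℤ) =
      gap (j + 1) (i + 1) * x - (if (j + 1) % 2 = (i + 1) % 2 then y else 0) - x from
    ⟨by rw [h]; ring, h⟩
  rcases Nat.even_or_odd' (i - (j + 2)) with ⟨c, hc | hc⟩
  · obtain rfl : i = j + 2 * c + 2 := by omega
    rw [count_pred_even j n c h₁ h₂, if_pos (by omega),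
      show gap (j + 1) (j + 2 * c + 2 + 1) = c + 2 by unfold gap; omega]
    push_cast
    rw [hx, hy]
    ring
  · obtain rfl : i = j + 2 * c + 3 := by omega
    rw [count_pred_odd j n c h₁ h₂, if_neg (by omega),
      show gap (j + 1) (j + 2 * c + 3 + 1) = c + 2 by unfold gap; omega]
    push_cast
    rw [hx]
    ring

/-- Here `n` is a partial Zeckendorf sum with top index `j + 1`, and `y` counts its partitions that
use `f (j + 1)`. The slack in `f (j + 1) ≤ n + 1` admits the start `j = n = 0`, a virtual index 1
with empty sum. -/
theorem F_add_sum (I : List ℕ) : ∀ (j n : ℕ) (x y : ℤ), f (j + 1) ≤ n + 1 → n < f (j + 2) →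
    (count (j + 1) n : ℤ) = x → (count j n : ℤ) = x - y →
    ((j + 1) :: I).IsChain (fun a b => a + 2 ≤ b) →
    (F (n + (I.map f).sum) : ℤ) = run (j + 1) x y I := by
  induction I with
  | nil =>
    intro j n x y h₁ h₂ hx hy _
    simpa [run, F_eq_count h₂] using hx
  | cons i I ih =>
    intro j n x y h₁ h₂ hx hy hc
    rw [List.isChain_cons_cons] at hc
    obtain ⟨i, rfl⟩ : ∃ i', i = i' + 1 := ⟨i - 1, by omega⟩
    obtain ⟨e₁, e₂⟩ := count_step j n i x y h₁ h₂ hx hy (by omega)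
    have h₃ := f_add_two i
    have h₄ : f (j + 2) ≤ f i := f_mono (by omega)
    rw [run, ← ih i (f (i + 1) + n) _ x (by omega) (by omega) e₁ e₂ hc.2, List.map_cons,
      List.sum_cons]
    congr 2
    ring

-- Zeckendorf index lists and the product formula

/-- Lists of indices `i₁ < i₂ < ⋯` with `1 ≤ i₁` and gaps at least two. -/
def IsIndexList (I : List ℕ) : Prop := I.IsChain (fun a b => a + 2 ≤ b) ∧ ∀ i ∈ I, 1 ≤ i

theorem F_sum_eq_run {I : List ℕ} (h : IsIndexList I) :
    (F (I.map f).sum : ℤ) = run 1 1 0 I := by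
  by_cases hI : ((0 + 1) :: I).IsChain (fun a b => a + 2 ≤ b)
  · simpa using F_add_sum I 0 0 1 0 (by decide) (by decide) (by decide) (by decide) hI
  · obtain ⟨h₁, h₂⟩ := h
    cases I with
    | nil => simp at hI
    | cons i I =>
      -- A first index 1 or 2 is too close to the virtual index 1, so the induction starts after it.
      have hi : i = 0 + 1 ∨ i = 1 + 1 := by
        have := h₂ i (by simp)
        by_contra h'
        exact hI (List.isChain_cons_cons.2 ⟨by omega, h₁⟩)
      rcases hi with rfl | rfl
      · rw [run, List.map_cons, List.sum_cons, F_add_sum I 0 (f 1) 1 1 (by decide) (by decide)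
          (by decide) (by decide) h₁]
        simp [gap]
      · rw [run, List.map_cons, List.sum_cons, F_add_sum I 1 (f 2) 1 1 (by decide) (by decide)
          (by decide) (by decide) h₁]
        simp [gap]

theorem isIndexList_Z (n : ℕ) : IsIndexList (Z n) := by
  have h := Nat.isZeckendorfRep_zeckendorf n
  have h2 := two_le_of_isZeckendorfRep h
  refine ⟨?_, ?_⟩
  · rw [Z, List.isChain_reverse, List.isChain_map]
    rw [List.IsZeckendorfRep] at h
    exact h.left_of_append.imp_of_mem_imp fun a b ha hb hab => by
      have := h2 b hb
      omega
  · intro i hi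
    simp only [Z, List.mem_reverse, List.mem_map] at hi
    obtain ⟨j, hj, rfl⟩ := hi
    have := h2 j hj
    omega

theorem Z_sum {I : List ℕ} (h : IsIndexList I) : Z (I.map f).sum = I := by
  have hz : ((I.map (· + 1)).reverse).IsZeckendorfRep := by
    rw [List.IsZeckendorfRep, List.isChain_append]
    refine ⟨?_, by simp, ?_⟩
    · rw [List.isChain_reverse, List.isChain_map]
      exact h.1.imp fun a b hab => by omega
    · intro x hx y hy
      have := List.mem_of_mem_getLast? hx
      simp only [List.mem_reverse, List.mem_map] at this
      obtain ⟨i, hi, rfl⟩ := this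
      have := h.2 i hi
      simp at hy
      omega
  have hs : (I.map f).sum = (((I.map (· + 1)).reverse).map Nat.fib).sum := by
    rw [List.map_reverse, List.sum_reverse, List.map_map]
    rfl
  rw [Z, hs, Nat.zeckendorf_sum_fib hz, List.map_reverse, List.reverse_reverse, List.map_map]
  simp [Function.comp_def]

theorem F_eq_prod_cont (n : ℕ) : (F n : ℤ) = ((multivec (Z n)).map cont).prod := by
  rw [multivec_eq_blocks, ← run_one, ← F_sum_eq_run (isIndexList_Z n), sum_f_Z]

-- Continued fractions and their denominators

theorem contTail_lt_cont {l : List ℕ} (h : ∀ a ∈ l, 2 ≤ a) : 0 ≤ contTail l ∧ contTail l < cont l := by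
  induction l with
  | nil => simp [cont, contTail]
  | cons a l ih =>
    obtain ⟨h₁, h₂⟩ := ih fun b hb => h b (List.mem_cons_of_mem _ hb)
    have ha : (2 : ℤ) ≤ a := by exact_mod_cast h a (by simp)
    simp only [cont, contTail]
    constructor <;> nlinarith

theorem cf_eq_of_two_le {l : List ℕ} (h : ∀ a ∈ l, 2 ≤ a) : cf l = contTail l / cont l := by
  induction l with
  | nil => simp [cont, contTail, cf]
  | cons a l ih =>
    have h' : ∀ b ∈ l, 2 ≤ b := fun b hb => h b (List.mem_cons_of_mem _ hb)
    have := contTail_lt_cont h'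
    have h₀ : (cont l : ℚ) ≠ 0 := by exact_mod_cast (this.1.trans_lt this.2).ne'
    rw [cf, ih h', cont, contTail]
    push_cast
    rw [sub_div' h₀, one_div_div]

theorem cont_cons_pos {a : ℕ} {l : List ℕ} (ha : 1 ≤ a) (h : ∀ b ∈ l, 2 ≤ b) :
    0 < cont (a :: l) := by
  have := contTail_lt_cont h
  have ha : (1 : ℤ) ≤ a := by exact_mod_cast ha
  simp only [cont]
  nlinarith

theorem cf_cons {a : ℕ} {l : List ℕ} (h : ∀ b ∈ l, 2 ≤ b) :
    cf (a :: l) = contTail (a :: l) / cont (a :: l) := by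
  have := contTail_lt_cont h
  have h₀ : (cont l : ℚ) ≠ 0 := by exact_mod_cast (this.1.trans_lt this.2).ne'
  rw [cf, cf_eq_of_two_le h, cont, contTail]
  push_cast
  rw [sub_div' h₀, one_div_div]

theorem isCoprime_cont (l : List ℕ) : IsCoprime (contTail l) (cont l) := by
  induction l with
  | nil => exact ⟨0, 1, by simp [cont]⟩
  | cons a l ih =>
    simp only [cont, contTail]
    obtain ⟨u, v, h⟩ := ih
    exact ⟨v + a * u, -u, by linear_combination h⟩

theorem den_cf {a : ℕ} {l : List ℕ} (ha : 1 ≤ a) (h : ∀ b ∈ l, 2 ≤ b) :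
    ((cf (a :: l)).den : ℤ) = cont (a :: l) := by
  rw [cf_cons h]
  exact Rat.den_div_eq_of_coprime (cont_cons_pos ha h)
    (Int.isCoprime_iff_nat_coprime.1 (isCoprime_cont _))

theorem cf_nonneg_lt_one {l : List ℕ} (h : ∀ a ∈ l, 2 ≤ a) : 0 ≤ cf l ∧ cf l < 1 := by
  obtain ⟨h₁, h₂⟩ := contTail_lt_cont h
  have h₁' : (0 : ℚ) ≤ contTail l := by exact_mod_cast h₁
  have h₂' : (contTail l : ℚ) < cont l := by exact_mod_cast h₂
  rw [cf_eq_of_two_le h]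
  exact ⟨div_nonneg h₁' (h₁'.trans h₂'.le), (div_lt_one (h₁'.trans_lt h₂')).2 h₂'⟩

theorem cf_cons_pos {a : ℕ} {l : List ℕ} (ha : 1 ≤ a) (h : ∀ b ∈ l, 2 ≤ b) : 0 < cf (a :: l) := by
  have := cf_nonneg_lt_one h
  have : (1 : ℚ) ≤ a := by exact_mod_cast ha
  rw [cf]
  exact one_div_pos.2 (by linarith)

-- Weights, multivectors and sizes of indices

/-- The sum of the entries of a list, each lowered by one. -/
def weight (l : List ℕ) : ℕ := (l.map (· - 1)).sum

theorem weight_cons (a : ℕ) (l : List ℕ) : weight (a :: l) = a - 1 + weight l := by simp [weight]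

/-- An entry `a` after the first costs an index increase of at least `2 * (a - 1)`, plus one at a
parity change. Only the first entry can be 1. -/
theorem blocks_spec (I : List ℕ) : ∀ prev i, (i :: I).IsChain (fun a b => a + 2 ≤ b) →
    ∃ H T, blocks prev (i :: I) = (gap prev i :: H) :: T ∧ (∀ b ∈ H, 2 ≤ b) ∧
      (∀ B ∈ T, B ≠ [] ∧ ∀ b ∈ B, 2 ≤ b) ∧
      H.length + (T.map List.length).sum = I.length ∧
      ∃ e ∈ i :: I, i + 2 * (weight H + (T.map weight).sum) + T.length ≤ e := by
  induction I with
  | nil => exact fun prev i _ => ⟨[], [], rfl, by simp, by simp, by simp, i, by simp, by simp [weight]⟩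
  | cons j I ih =>
    intro prev i hc
    rw [List.isChain_cons_cons] at hc
    obtain ⟨H, T, h, hs, hd⟩ := blocks_cons_cons prev i j I
    obtain ⟨H', T', h', h₁, h₂, h₃, e, he, h₄⟩ := ih i j hc.2
    obtain ⟨rfl, rfl⟩ : H = H' ∧ T = T' := by simpa using h.symm.trans h'
    have hg : 2 ≤ gap i j := by unfold gap; omega
    by_cases hij : i % 2 = j % 2
    · have hp : 2 * (gap i j - 1) + i ≤ j := by unfold gap; omega
      refine ⟨_, _, hs hij, ?_, h₂, ?_, e, List.mem_cons_of_mem _ he, ?_⟩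
      · simpa using ⟨hg, h₁⟩
      · simp only [List.length_cons]
        omega
      · rw [weight_cons]
        omega
    · have hp : 2 * (gap i j - 1) + i + 1 ≤ j := by unfold gap; omega
      refine ⟨_, _, hd hij, by simp, ?_, ?_, e, List.mem_cons_of_mem _ he, ?_⟩
      · simpa using ⟨⟨hg, h₁⟩, h₂⟩
      · simp only [List.map_cons, List.sum_cons, List.length_cons, List.length_nil]
        omega
      · simp only [List.map_cons, List.sum_cons, List.length_cons, weight,
          List.map_nil, List.sum_nil] at h₄ ⊢
        omega

theorem exists_cf_eq (k : ℕ) : ∀ q < k, ∃ l : List ℕ, (∀ a ∈ l, 2 ≤ a) ∧ cf l = q / k ∧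
    weight l + 1 ≤ k := by
  induction k using Nat.strong_induction_on with
  | _ k ih =>
    intro q hq
    rcases Nat.eq_zero_or_pos q with rfl | hq₀
    · exact ⟨[], by simp, by simp [cf], by simp [weight]; omega⟩
    · obtain ⟨a, r, hr, h⟩ : ∃ a r, r < q ∧ a * q = k + r := by
        -- Division rounded up: `a` is the ceiling of `k / q`.
        refine ⟨(k + q - 1) / q, q - 1 - (k + q - 1) % q, by omega, ?_⟩
        have h₁ := Nat.div_add_mod (k + q - 1) q
        have h₂ := Nat.mod_lt (k + q - 1) hq₀
        rw [mul_comm]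
        omega
      have ha : 2 ≤ a := by
        by_contra h'
        have : a * q ≤ 1 * q := Nat.mul_le_mul_right _ (by omega)
        omega
      obtain ⟨l, h₁, h₂, h₃⟩ := ih q hq r hr
      refine ⟨a :: l, by simpa using ⟨ha, h₁⟩, ?_, ?_⟩
      · have hq' : (q : ℚ) ≠ 0 := by positivity
        rw [cf, h₂, sub_div' hq', one_div_div]
        congr 1
        rw [sub_eq_iff_eq_add]
        exact_mod_cast h
      · obtain ⟨a, rfl⟩ := Nat.exists_eq_add_of_le ha
        obtain ⟨q, rfl⟩ : ∃ q', q = q' + 1 := ⟨q - 1, by omega⟩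
        rw [weight_cons]
        -- After the shifts this is (a - 2)(q - 1) ≥ 0 in the original variables, exactly what the
        -- weight bound needs.
        have : 0 ≤ a * q := Nat.zero_le _
        have : (2 + a) * (q + 1) = a * q + 2 * q + a + 2 := by ring
        omega

/-- Two differences, `2 * (a - 1)` and one more, give the entry `a`; `b` selects between them, being
0 inside a block and 1 when a later block begins. -/
theorem exists_blocks_eq (T : List (List ℕ)) : ∀ (l : List ℕ) (a prev b : ℕ), b ≤ 1 → 2 ≤ a →
    (∀ x ∈ l, 2 ≤ x) → (∀ B ∈ T, B ≠ [] ∧ ∀ x ∈ B, 2 ≤ x) →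
    ∃ i I, blocks prev (i :: I) = (a :: l) :: T ∧ (i :: I).IsChain (fun a b => a + 2 ≤ b) ∧
      i % 2 = (prev + b) % 2 ∧ prev + 2 ≤ i ∧
      ∀ e ∈ i :: I, e ≤ prev + b + 2 * (weight (a :: l) + (T.map weight).sum) + T.length := by
  induction T with
  | nil =>
    intro l
    induction l with
    | nil =>
      refine fun a prev b hb ha _ _ => ⟨prev + 2 * (a - 1) + b, [], ?_, by simp, by omega, by omega, ?_⟩
      · rw [blocks, show gap prev (prev + 2 * (a - 1) + b) = a by unfold gap; omega]
      · simp [weight]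
        omega
    | cons a' l ih =>
      intro a prev b hb ha hl _
      have hl' : 2 ≤ a' ∧ ∀ x ∈ l, 2 ≤ x := by simpa using hl
      obtain ⟨j, I, h₁, h₂, h₃, h₄, h₅⟩ :=
        ih a' (prev + 2 * (a - 1) + b) 0 (by omega) hl'.1 hl'.2 (by simp)
      refine ⟨prev + 2 * (a - 1) + b, j :: I, ?_, List.isChain_cons_cons.2 ⟨h₄, h₂⟩, by omega,
        by omega, ?_⟩
      · rw [blocks, if_pos (by omega), h₁, consHead,
          show gap prev (prev + 2 * (a - 1) + b) = a by unfold gap; omega]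
      · intro e he
        rw [weight_cons]
        rcases List.mem_cons.1 he with rfl | he
        · omega
        · have := h₅ e he
          omega
  | cons B T ihT =>
    intro l
    induction l with
    | nil =>
      intro a prev b hb ha _ hT
      rw [List.forall_mem_cons] at hT
      obtain ⟨⟨hB, hB'⟩, hT⟩ := hT
      obtain ⟨a', l, rfl⟩ := List.exists_cons_of_ne_nil hB
      have hl' : 2 ≤ a' ∧ ∀ x ∈ l, 2 ≤ x := by simpa using hB'
      obtain ⟨j, I, h₁, h₂, h₃, h₄, h₅⟩ :=
        ihT l a' (prev + 2 * (a - 1) + b) 1 (by omega) hl'.1 hl'.2 hT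
      refine ⟨prev + 2 * (a - 1) + b, j :: I, ?_, List.isChain_cons_cons.2 ⟨h₄, h₂⟩, by omega,
        by omega, ?_⟩
      · rw [blocks, if_neg (by omega), h₁,
          show gap prev (prev + 2 * (a - 1) + b) = a by unfold gap; omega]
      · intro e he
        rw [weight_cons, List.map_cons, List.sum_cons, List.length_cons]
        rcases List.mem_cons.1 he with rfl | he
        · omega
        · have := h₅ e he
          omega
    | cons a' l ih =>
      intro a prev b hb ha hl hT
      have hl' : 2 ≤ a' ∧ ∀ x ∈ l, 2 ≤ x := by simpa using hl
      obtain ⟨j, I, h₁, h₂, h₃, h₄, h₅⟩ :=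
        ih a' (prev + 2 * (a - 1) + b) 0 (by omega) hl'.1 hl'.2 hT
      refine ⟨prev + 2 * (a - 1) + b, j :: I, ?_, List.isChain_cons_cons.2 ⟨h₄, h₂⟩, by omega,
        by omega, ?_⟩
      · rw [blocks, if_pos (by omega), h₁, consHead,
          show gap prev (prev + 2 * (a - 1) + b) = a by unfold gap; omega]
      · intro e he
        rw [weight_cons]
        rcases List.mem_cons.1 he with rfl | he
        · omega
        · have := h₅ e he
          omega

/-- Telescoping: `f j + f (j + 1) = f (j + 2)`, which is at most the term just below the next index.
-/
theorem add_sum_f_le (I : List ℕ) : ∀ j M, ((j + 1) :: I).IsChain (fun a b => a + 2 ≤ b) →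
    (∀ e ∈ (j + 1) :: I, e ≤ M) → f j + (((j + 1) :: I).map f).sum ≤ f (M + 1) := by
  induction I with
  | nil =>
    intro j M _ h
    have h₁ := f_add_two j
    have h₂ : f (j + 2) ≤ f (M + 1) := f_mono (by simpa using h)
    simp
    omega
  | cons i I ih =>
    intro j M hc h
    rw [List.isChain_cons_cons] at hc
    obtain ⟨i, rfl⟩ : ∃ i', i = i' + 1 := ⟨i - 1, by omega⟩
    have h₀ := ih i M hc.2 fun e he => h e (List.mem_cons_of_mem _ he)
    have h₁ := f_add_two j
    have h₂ : f (j + 2) ≤ f i := f_mono (by omega)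
    simp only [List.map_cons, List.sum_cons] at h₀ ⊢
    omega

theorem le_sum_f (I : List ℕ) : ∀ prev, (∀ i ∈ I.head?, prev + 2 ≤ i) →
    I.IsChain (fun a b => a + 2 ≤ b) →
    f (prev + 1 + 2 * I.length) ≤ f (prev + 1) + (I.map f).sum := by
  induction I with
  | nil => simp
  | cons i I ih =>
    intro prev h hc
    rw [List.isChain_cons] at hc
    have hi : prev + 2 ≤ i := h i (by simp)
    have h₀ := ih (prev + 2) (fun j hj => by have := hc.1 j hj; omega) hc.2
    have h₁ : f (prev + 3) = f (prev + 2) + f (prev + 1) := f_add_two (prev + 1)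
    have h₂ : f (prev + 2) ≤ f i := f_mono hi
    simp only [List.map_cons, List.sum_cons, List.length_cons]
    rw [show prev + 1 + 2 * (I.length + 1) = prev + 2 + 1 + 2 * I.length by ring]
    rw [show prev + 2 + 1 = prev + 3 by ring] at h₀ ⊢
    omega

-- Expansions attached to the class of (k - 1) / k

theorem weight_replicate_two (k : ℕ) : weight (List.replicate k 2) = k := by simp [weight]

theorem eq_replicate_of_cf_eq {l : List ℕ} : ∀ {k : ℕ}, (∀ a ∈ l, 2 ≤ a) →
    cf l = k / (k + 1) → l = List.replicate k 2 := by
  induction l with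
  | nil =>
    intro k _ h
    have : (k : ℚ) = 0 := by
      have h' : (k : ℚ) + 1 ≠ 0 := by positivity
      rw [cf] at h
      simpa [h'] using h.symm
    obtain rfl : k = 0 := by exact_mod_cast this
    rfl
  | cons a l ih =>
    intro k h hcf
    have h' : 2 ≤ a ∧ ∀ x ∈ l, 2 ≤ x := by simpa using h
    have hpos := cf_cons_pos (a := a) (by omega) h'.2
    obtain ⟨h₀, h₁⟩ := cf_nonneg_lt_one h'.2
    rw [hcf] at hpos
    rcases k with _ | k
    · simp at hpos
    rw [cf] at hcf
    push_cast at hcf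
    have hk : (0 : ℚ) ≤ k := by positivity
    have ha : (2 : ℚ) ≤ a := by exact_mod_cast h'.1
    rw [div_eq_div_iff (by linarith) (by linarith)] at hcf
    have ha2 : a = 2 := by
      by_contra hne
      have : (3 : ℚ) ≤ a := by exact_mod_cast (show 3 ≤ a by omega)
      nlinarith
    subst ha2
    rw [List.replicate_succ, ← ih h'.2]
    rw [eq_div_iff (by linarith)]
    push_cast at hcf
    linarith

/-- The expansion is forced to be `m` twos, a 3, then `k` twos, of weight m + 2 + k. It arises as
the tail after a leading 1. -/
theorem le_weight_of_cf_eq {l : List ℕ} : ∀ {k m : ℕ}, (∀ a ∈ l, 2 ≤ a) →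
    cf l = 1 - (k + 2) / ((m + 2) * (k + 2) - 1) → k + 2 ≤ weight l := by
  induction l with
  | nil =>
    intro k m _ h
    have hk : (0 : ℚ) ≤ k := by positivity
    have hm : (0 : ℚ) ≤ m := by positivity
    have hmk : (0 : ℚ) ≤ m * k := by positivity
    have h0 : (0 : ℚ) < (m + 2) * (k + 2) - 1 := by nlinarith
    rw [cf, eq_comm, sub_eq_zero, eq_div_iff h0.ne'] at h
    nlinarith
  | cons a l ih =>
    intro k m h hcf
    have h' : 2 ≤ a ∧ ∀ x ∈ l, 2 ≤ x := by simpa using h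
    obtain ⟨h₀, h₁⟩ := cf_nonneg_lt_one h'.2
    have ha : (2 : ℚ) ≤ a := by exact_mod_cast h'.1
    have hk : (0 : ℚ) ≤ k := by positivity
    have hm : (0 : ℚ) ≤ m := by positivity
    have hmk : (0 : ℚ) ≤ m * k := by positivity
    have hd : (0 : ℚ) < (m + 2) * (k + 2) - 1 := by nlinarith
    rw [cf, one_sub_div hd.ne', div_eq_div_iff (by linarith) hd.ne'] at hcf
    rw [weight_cons]
    rcases m with _ | m
    · push_cast at hcf
      have ha3 : a = 3 := by
        have h2 : (2 : ℚ) < a := by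
          by_contra hne
          have : (a : ℚ) = 2 := le_antisymm (not_lt.1 hne) ha
          rw [this] at hcf
          nlinarith
        have h4 : (a : ℚ) < 4 := by
          by_contra hne
          nlinarith
        have : 2 < a := by exact_mod_cast h2
        have : a < 4 := by exact_mod_cast h4
        omega
      subst ha3
      have := eq_replicate_of_cf_eq (l := l) (k := k) h'.2 (by
        rw [eq_div_iff (by linarith)]
        push_cast at hcf
        linarith)
      rw [this, weight_replicate_two]
      omega
    · push_cast at hcf
      have ha2 : a = 2 := by
        by_contra hne
        have : (3 : ℚ) ≤ a := by exact_mod_cast (show 3 ≤ a by omega)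
        have hmk : (0 : ℚ) ≤ m * k := by positivity
        have hm : (0 : ℚ) ≤ m := by positivity
        nlinarith [mul_nonneg (sub_nonneg.2 this) hmk, mul_nonneg (sub_nonneg.2 this) hm,
          mul_nonneg (sub_nonneg.2 this) hk, mul_nonneg (sub_pos.2 h₁).le hmk,
          mul_nonneg (sub_pos.2 h₁).le hm, mul_nonneg (sub_pos.2 h₁).le hk]
      subst ha2
      have hmk : (0 : ℚ) ≤ m * k := by positivity
      have hm : (0 : ℚ) ≤ m := by positivity
      have hd' : (0 : ℚ) < (m + 2) * (k + 2) - 1 := by nlinarith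
      have := ih (k := k) (m := m) h'.2 (by
        rw [one_sub_div hd'.ne', eq_div_iff hd'.ne']
        push_cast at hcf
        linarith)
      omega

-- Orders and letters in the free monoid

/-- The product of the orders of the letters of an element of `Gam`. -/
noncomputable def order : Gam →* ℕ := FreeMonoid.lift fun x => addOrderOf x.1

theorem order_letter (g : ℚ) : order (letter g) = g.den := by
  have h : addOrderOf (g : AddCircle (1 : ℚ)) = g.den := by
    have : Fact ((0 : ℚ) < 1) := ⟨one_pos⟩
    have := AddCircle.addOrderOf_coe_rat (p := (1 : ℚ)) (q := g)
    rwa [mul_one] at this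
  unfold letter
  split_ifs with h₀
  · rw [h₀, addOrderOf_zero] at h
    simpa using h
  · simpa [order] using h

theorem order_p {L : List (List ℕ)} (h : ∀ A ∈ L, ∃ a l, A = a :: l ∧ 1 ≤ a ∧ ∀ b ∈ l, 2 ≤ b) :
    (order (p L) : ℤ) = (L.map cont).prod := by
  induction L with
  | nil => simp [p]
  | cons A L ih =>
    rw [List.forall_mem_cons] at h
    obtain ⟨⟨a, l, rfl, ha, hl⟩, h⟩ := h
    have := ih h
    simp only [p] at this ⊢
    rw [List.map_cons, List.prod_cons, map_mul, Nat.cast_mul, this, order_letter, den_cf ha hl,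
      List.map_cons, List.prod_cons]

theorem order_proj (n : ℕ) : order (proj n) = F n := by
  have : (order (proj n) : ℤ) = F n := by
    rw [F_eq_prod_cont, proj, order_p]
    intro A hA
    obtain ⟨hc, -⟩ := isIndexList_Z n
    rw [multivec_eq_blocks] at hA
    cases hI : Z n with
    | nil => simp [hI, blocks] at hA
    | cons i I =>
      rw [hI] at hc hA
      obtain ⟨H, T, h, h₁, h₂, -⟩ := blocks_spec I 1 i hc
      rw [h, List.mem_cons] at hA
      rcases hA with rfl | hA
      · exact ⟨_, _, rfl, by unfold gap; omega, h₁⟩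
      · obtain ⟨hB, hB'⟩ := h₂ A hA
        obtain ⟨b, l, rfl⟩ := List.exists_cons_of_ne_nil hB
        rw [List.forall_mem_cons] at hB'
        exact ⟨b, l, rfl, by omega, hB'.2⟩
  exact_mod_cast this

theorem coe_eq_coe_iff {g h : ℚ} : (g : AddCircle (1 : ℚ)) = h ↔ ∃ m : ℤ, g = h + m := by
  rw [← sub_eq_zero, ← AddCircle.coe_sub, AddCircle.coe_eq_zero_iff]
  refine exists_congr fun m => ?_
  rw [zsmul_eq_mul, mul_one, eq_comm, sub_eq_iff_eq_add']

theorem letter_eq_letter_iff {g h : ℚ} : letter g = letter h ↔ ∃ m : ℤ, g = h + m := by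
  rw [← coe_eq_coe_iff]
  unfold letter
  by_cases hg : (g : AddCircle (1 : ℚ)) = 0 <;> by_cases hh : (h : AddCircle (1 : ℚ)) = 0
  · simp [hg, hh]
  · simp [hg, hh, Ne.symm hh, FreeMonoid.one_ne_of]
  · simp [hg, hh, FreeMonoid.of_ne_one]
  · simp only [hg, hh, dif_neg, not_false_iff]
    exact ⟨fun e => congrArg Subtype.val (FreeMonoid.of_injective e), fun e => by simp [e]⟩

theorem letter_zero : letter 0 = 1 := by simp [letter]

theorem eq_of_letter_eq_letter {g h : ℚ} (hg : 0 ≤ g ∧ g < 1) (hh : 0 ≤ h ∧ h < 1)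
    (e : letter g = letter h) : g = h := by
  obtain ⟨m, hm⟩ := letter_eq_letter_iff.1 e
  have h₁ : (m : ℚ) < 1 := by linarith
  have h₂ : (-1 : ℚ) < m := by linarith
  have h₃ : m < 1 := by exact_mod_cast h₁
  have h₄ : -1 < m := by exact_mod_cast h₂
  obtain rfl : m = 0 := by omega
  simpa using hm

theorem length_letter {g : ℚ} (hg : 0 < g ∧ g < 1) : (letter g).length = 1 := by
  unfold letter
  rw [dif_neg, FreeMonoid.length_of]
  intro h
  have := eq_of_letter_eq_letter ⟨hg.1.le, hg.2⟩ ⟨le_rfl, one_pos⟩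
    (by rw [letter_zero, letter, dif_pos h])
  exact hg.1.ne' this

theorem length_letter_cf {B : List ℕ} (hB : B ≠ []) (h : ∀ b ∈ B, 2 ≤ b) :
    (letter (cf B)).length = 1 := by
  refine length_letter ⟨?_, (cf_nonneg_lt_one h).2⟩
  obtain ⟨b, l, rfl⟩ := List.exists_cons_of_ne_nil hB
  rw [List.forall_mem_cons] at h
  exact cf_cons_pos (by omega) h.2

theorem p_cons (A : List ℕ) (L : List (List ℕ)) : p (A :: L) = letter (cf A) * p L := by simp [p]

theorem length_p {L : List (List ℕ)} (h : ∀ B ∈ L, B ≠ [] ∧ ∀ b ∈ B, 2 ≤ b) :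
    (p L).length = L.length := by
  induction L with
  | nil => simp [p]
  | cons A L ih =>
    rw [List.forall_mem_cons] at h
    rw [p_cons, FreeMonoid.length_mul, ih h.2, length_letter_cf h.1.1 h.1.2, List.length_cons,
      add_comm]

-- Upper bound for θ

/-- Every element of `Gam` is given by a multivector whose weight is bounded by its order. -/
theorem exists_p_eq (γ : Gam) : ∃ L : List (List ℕ), (∀ B ∈ L, B ≠ [] ∧ ∀ b ∈ B, 2 ≤ b) ∧ p L = γ ∧
    (L = [] ∨ 2 ≤ order γ ∧ 2 * (L.map weight).sum + L.length + 1 ≤ 2 * order γ) := by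
  induction γ using FreeMonoid.inductionOn' with
  | one => exact ⟨[], by simp, by simp [p], Or.inl rfl⟩
  | of_mul x γ ih =>
    obtain ⟨L, h₁, rfl, h₃⟩ := ih
    obtain ⟨x, hx⟩ := x
    obtain ⟨g, rfl⟩ := QuotientAddGroup.mk_surjective x
    have hg₀ := Int.fract_nonneg g
    have hg₁ := Int.fract_lt_one g
    set r := Int.fract g with hr
    have hx' : FreeMonoid.of ⟨(QuotientAddGroup.mk g : AddCircle (1 : ℚ)), hx⟩ = letter r := by
      have : letter g = letter r := letter_eq_letter_iff.2 ⟨⌊g⌋, (Int.fract_add_floor g).symm⟩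
      rw [← this, letter, dif_neg hx]
    have hr₀ : letter r ≠ 1 := by rw [← hx']; exact FreeMonoid.of_ne_one _
    have hnum : r.num.toNat < r.den := by
      have := Rat.num_lt_denom_iff.2 hg₁
      have := r.pos
      omega
    obtain ⟨A, hA, hA', hw⟩ := exists_cf_eq r.den r.num.toNat hnum
    have hrA : cf A = r := by
      rw [hA']
      have h : ((r.num.toNat : ℤ) : ℚ) = r.num := by
        rw [Int.toNat_of_nonneg (Rat.num_nonneg.2 hg₀)]
      rw [← Int.cast_natCast, h, Rat.num_div_den]
    have hA₀ : A ≠ [] := by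
      rintro rfl
      exact hr₀ (by rw [← hrA, cf, letter_zero])
    have hden : 2 ≤ r.den := by
      by_contra h
      have h₁ : r.den = 1 := by have := r.pos; omega
      have h₂ : r.num = 0 := by
        have := Rat.num_nonneg.2 hg₀
        omega
      exact hr₀ (by rw [Rat.num_eq_zero.1 h₂, letter_zero])
    rw [hx']
    refine ⟨A :: L, List.forall_mem_cons.2 ⟨⟨hA₀, hA⟩, h₁⟩, by rw [p_cons, hrA], Or.inr ?_⟩
    rw [map_mul, order_letter, List.map_cons, List.sum_cons, List.length_cons]
    rcases h₃ with rfl | ⟨h₃, h₄⟩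
    · simp [p]
      omega
    · obtain ⟨u, hu⟩ := Nat.exists_eq_add_of_le h₃
      obtain ⟨v, hv⟩ := Nat.exists_eq_add_of_le hden
      rw [hu] at h₄ ⊢
      rw [hv] at hw ⊢
      -- For two factors at least 2 the product is at least the sum, so concatenation preserves the
      -- bound.
      have : (2 + v) * (2 + u) = 4 + 2 * u + 2 * v + v * u := by ring
      omega

theorem exists_proj_eq (γ : Gam) : ∃ n, proj n = γ ∧ n + 2 ≤ f (2 * order γ) := by
  obtain ⟨L, h₁, rfl, h₃⟩ := exists_p_eq γ
  rcases L with _ | ⟨A, T⟩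
  · exact ⟨0, by rw [proj_zero]; simp [p], by simp [p, f]; decide⟩
  · rw [List.forall_mem_cons] at h₁
    obtain ⟨⟨hA, hA'⟩, hT⟩ := h₁
    obtain ⟨a, l, rfl⟩ := List.exists_cons_of_ne_nil hA
    rw [List.forall_mem_cons] at hA'
    obtain ⟨i, I, e₁, e₂, -, e₃, e₄⟩ := exists_blocks_eq T l a 1 0 (by omega) hA'.1 hA'.2 hT
    have hI : IsIndexList (i :: I) := by
      refine ⟨e₂, ?_⟩
      have : IsTrans ℕ (fun a b : ℕ => a + 2 ≤ b) := ⟨fun _ _ _ h₁ h₂ => by omega⟩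
      have := (List.pairwise_cons.1 (List.isChain_iff_pairwise.1 e₂)).1
      intro j hj
      rcases List.mem_cons.1 hj with rfl | hj
      · omega
      · have := this j hj
        omega
    refine ⟨((i :: I).map f).sum, by rw [proj, Z_sum hI, multivec_eq_blocks, e₁], ?_⟩
    obtain ⟨j, rfl⟩ : ∃ j, i = j + 1 := ⟨i - 1, by omega⟩
    have h₄ : 2 * (((a :: l) :: T).map weight).sum + ((a :: l) :: T).length + 1 ≤
        2 * order (p ((a :: l) :: T)) := (h₃.resolve_left (by simp)).2
    rw [List.map_cons, List.sum_cons, List.length_cons] at h₄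
    have := add_sum_f_le I j (2 * order (p ((a :: l) :: T)) - 1) e₂ fun e he => by
      have := e₄ e he
      omega
    rw [Nat.sub_add_cancel (by omega)] at this
    -- The first entry is at least 2, so the first index is at least 3; this is the source of the 2
    -- in the bound.
    have h2 : f 2 ≤ f j := f_mono (by omega)
    rw [show f 2 = 2 from rfl] at h2
    omega

theorem proj_θ (γ : Gam) : proj (θ γ) = γ := by
  obtain ⟨n, hn, -⟩ := exists_proj_eq γ
  exact Nat.sInf_mem (s := {n | proj n = γ}) ⟨n, hn⟩

theorem F_θ (γ : Gam) : F (θ γ) = order γ := by rw [← order_proj, proj_θ]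

theorem θ_add_two_le (γ : Gam) : θ γ + 2 ≤ f (2 * order γ) := by
  obtain ⟨n, hn, h⟩ := exists_proj_eq γ
  have : θ γ ≤ n := Nat.sInf_le hn
  omega

-- Lower bound for the class of (k - 1) / k

/-- The multivectors over the class of `(k + 1) / (k + 2)`. -/
theorem of_p_eq_letter {k a : ℕ} {H : List ℕ} {T : List (List ℕ)} (ha : 1 ≤ a)
    (hH : ∀ b ∈ H, 2 ≤ b) (hT : ∀ B ∈ T, B ≠ [] ∧ ∀ b ∈ B, 2 ≤ b)
    (h : p ((a :: H) :: T) = letter ((k + 1) / (k + 2))) :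
    (T = [] ∧ a :: H = List.replicate (k + 1) 2) ∨
      2 * k + 3 ≤ 2 * (weight H + (T.map weight).sum) + T.length := by
  have hk : (0 : ℚ) ≤ k := by positivity
  have hx : (0 : ℚ) < (k + 1) / (k + 2) ∧ ((k : ℚ) + 1) / (k + 2) < 1 :=
    ⟨by positivity, by rw [div_lt_one (by positivity)]; linarith⟩
  have two : ∀ B : List ℕ, (∀ b ∈ B, 2 ≤ b) → letter (cf B) = letter ((k + 1) / (k + 2)) →
      B = List.replicate (k + 1) 2 := by
    intro B hB e
    refine eq_replicate_of_cf_eq hB ?_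
    rw [eq_of_letter_eq_letter (cf_nonneg_lt_one hB) ⟨hx.1.le, hx.2⟩ e]
    push_cast
    ring
  have hlen := congrArg FreeMonoid.length h
  rw [p_cons, FreeMonoid.length_mul, length_p hT, length_letter hx] at hlen
  by_cases ha2 : 2 ≤ a
  · have hA : ∀ b ∈ a :: H, 2 ≤ b := List.forall_mem_cons.2 ⟨ha2, hH⟩
    rw [length_letter_cf (by simp) hA] at hlen
    obtain rfl : T = [] := List.length_eq_zero_iff.1 (by omega)
    refine Or.inl ⟨rfl, two _ hA ?_⟩
    simpa [p] using h
  · obtain rfl : a = 1 := by omega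
    right
    rcases T with _ | ⟨B, T⟩
    · obtain ⟨h₀, h₁⟩ := cf_nonneg_lt_one hH
      rw [p_cons, show p [] = 1 from rfl, mul_one] at h
      obtain ⟨m, hm⟩ := letter_eq_letter_iff.1 h
      rw [cf, Nat.cast_one] at hm
      have h1 : 1 ≤ 1 / (1 - cf H) := by rw [le_div_iff₀ (by linarith)]; linarith
      have hm0 : (0 : ℚ) < m := by linarith [hx.2]
      have hm0' : 0 < m := by exact_mod_cast hm0
      -- A leading 1 makes the fraction at least 1, so it exceeds its representative by a positive
      -- integer.
      obtain ⟨m, rfl⟩ : ∃ m' : ℕ, m = m' + 1 := ⟨(m - 1).toNat, by omega⟩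
      have := le_weight_of_cf_eq (k := k) (m := m) hH (by
        have hm' : (0 : ℚ) ≤ m := by positivity
        have hmk : (0 : ℚ) ≤ m * k := by positivity
        have hd : (0 : ℚ) < (m + 2) * (k + 2) - 1 := by nlinarith
        rw [div_add' _ _ _ (by positivity), div_eq_div_iff (by linarith) (by positivity)] at hm
        push_cast at hm
        rw [one_sub_div hd.ne', eq_div_iff hd.ne']
        linarith)
      simp
      omega
    · rw [List.length_cons] at hlen
      obtain rfl : T = [] := List.length_eq_zero_iff.1 (by omega)
      -- A one-letter word leaves no room for the first block: its fraction is an integer and the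
      -- second block carries the letter.
      have h1 : letter (cf (1 :: H)) = 1 := FreeMonoid.length_eq_zero.1 (by simpa using hlen)
      rw [p_cons, h1, one_mul, p_cons, show p [] = 1 from rfl, mul_one] at h
      rw [two B (hT B (by simp)).2 h]
      simp only [List.map_cons, weight_replicate_two, List.map_nil, List.sum_cons, List.sum_nil,
        List.length_cons, List.length_nil]
      omega

theorem f_le_of_proj_eq {k n : ℕ} (h : proj n = letter ((k + 1) / (k + 2))) :
    f (2 * k + 4) ≤ n + 2 := by
  obtain ⟨hc, hpos⟩ := isIndexList_Z n
  have hs := sum_f_Z n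
  rw [proj, multivec_eq_blocks] at h
  have hk : (0 : ℚ) ≤ k := by positivity
  rcases hI : Z n with _ | ⟨i, I⟩
  · have := congrArg FreeMonoid.length h
    rw [length_letter ⟨by positivity, by rw [div_lt_one (by positivity)]; linarith⟩, hI] at this
    simp [blocks, p] at this
  · rw [hI] at hc hpos h hs
    obtain ⟨H, T, e, h₁, h₂, h₃, x, hx, hx'⟩ := blocks_spec I 1 i hc
    have hi := hpos i (by simp)
    rw [e] at h
    rcases of_p_eq_letter (by unfold gap; omega) h₁ h₂ h with ⟨rfl, hr⟩ | hw
    · have hlen : (i :: I).length = k + 1 := by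
        have := congrArg List.length hr
        simp at this h₃ ⊢
        omega
      have hg : gap 1 i = 2 := by
        rw [List.replicate_succ, List.cons.injEq] at hr
        exact hr.1
      have := le_sum_f (i :: I) 1 (by simp; unfold gap at hg; omega) hc
      rw [hs, hlen, show f (1 + 1) = 2 from rfl, show 1 + 1 + 2 * (k + 1) = 2 * k + 4 by ring] at this
      omega
    · have h₄ : f x ≤ n := by
        rw [← hs]
        exact List.single_le_sum (fun _ _ => Nat.zero_le _) _ (List.mem_map_of_mem hx)
      have : f (2 * k + 4) ≤ f x := f_mono (by omega)
      omega

end FibPart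

theorem corollary4p3 (k : ℕ) (hk : 1 ≤ k) :
    IsGreatest (FibPart.essentialK k) (FibPart.f (2 * k) - 2) ∧
      FibPart.f (2 * k) - 2 = FibPart.θ (FibPart.letter (((k : ℚ) - 1) / (k : ℚ))) := by
  have hden : (((k : ℚ) - 1) / (k : ℚ)).den = k := by
    have h := Rat.den_div_eq_of_coprime (a := (k : ℤ) - 1) (b := k) (by omega)
      (Int.isCoprime_iff_nat_coprime.1 ⟨-1, 1, by ring⟩)
    push_cast at h
    exact_mod_cast h
  have hord : FibPart.order (FibPart.letter (((k : ℚ) - 1) / (k : ℚ))) = k := by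
    rw [FibPart.order_letter, hden]
  have hle := FibPart.θ_add_two_le (FibPart.letter (((k : ℚ) - 1) / (k : ℚ)))
  rw [hord] at hle
  have heq : FibPart.f (2 * k) - 2 = FibPart.θ (FibPart.letter (((k : ℚ) - 1) / (k : ℚ))) := by
    refine le_antisymm ?_ (by omega)
    -- For `k = 1` the letter is the unit and the claimed value is 0.
    obtain rfl | ⟨k, rfl⟩ : k = 1 ∨ ∃ m, k = m + 2 := by
      rcases k with _ | _ | k
      · omega
      · exact Or.inl rfl
      · exact Or.inr ⟨k, rfl⟩
    · exact Nat.zero_le _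
    · have := FibPart.f_le_of_proj_eq (k := k)
        (n := FibPart.θ (FibPart.letter (((k + 2 : ℕ) - 1 : ℚ) / (k + 2 : ℕ)))) (by
          rw [FibPart.proj_θ]
          congr 1
          push_cast
          ring)
      rw [show 2 * (k + 2) = 2 * k + 4 by ring]
      omega
  refine ⟨⟨⟨⟨_, heq.symm⟩, ?_⟩, ?_⟩, heq⟩
  · rw [heq, FibPart.F_θ, hord]
  · rintro _ ⟨⟨γ, rfl⟩, h⟩
    have := FibPart.θ_add_two_le γ
    rw [← FibPart.F_θ, h] at this
    omega
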